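/- Let $\mathbb F$ be a field of characteristic zero, and let $D_x=\partial/\partial x$, $D_y=\partial/\partial y$ on $\mathbb F(x,y)=\mathbb F(x)(y)$. Let $\Phi$ be a field extension of $\mathbb F(x,y)$ with commuting derivations extending $D_x$ and $D_y$. A nonzero $H\in\Phi$ is *hyperexponential* over $\mathbb F(x,y)$ if $D_x(H)/H$ and $D_y(H)/H$ lie in $\mathbb F(x,y)$. A *telescoper* for $H$ is a nonzero operator $L\in\mathbb F(x)\langle D_x\rangle$ with $L(H)=D_y(G)$ for some hyperexponential $G$; it is *minimal* if it generates the left ideal of all telescopers (together with $0$). A rational function $a/b\in\mathbb F(x)(y)$ in lowest terms is *differential-reduced* if $\gcd(b,a-i\,D_y(b))=1$ in $\mathbb F(x)[y]$ for all $i\in\mathbb Z$. Let $H$ be hyperexponential and let $K$ be a *kernel* and $S\neq 0$ a *shell* of $D_y(H)/H$: $K$ is differential-reduced, the denominators of $S$ and $K$ are coprime in $\mathbb F(x)[y]$, and $D_y(H)/H=K+D_y(S)/S$. Write $K=k_1/k_2$ with coprime $k_1,k_2\in\mathbb F(x)[y]$, let $T=H/S$, and let $b$ be the squarefree part of the denominator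 of $S$. Let $\mathcal M_K=\{k_2D_y(p)+k_1p : p\in\mathbb F(x)[y]\}$, and let $\mathcal N_K$ be the $\mathbb F(x)$-span of all monomials $y^\ell$ such that no nonzero element of $\mathcal M_K$ has degree $\ell$ in $y$ (equivalently, $\ell$ is not a degree occurring in a basis of $\mathcal M_K$ whose elements have distinct degrees). A *residual form* with respect to $K$ is a rational function $q/c+v/k_2$ with $c\in\mathbb F(x)[y]$ squarefree and coprime to $k_2$, $q\in\mathbb F(x)[y]$, $\deg_y q<\deg_y c$, and $v\in\mathcal N_K$. Then there is exactly one sequence $(r_i)_{i\ge 0}$ of residual forms with respect to $K$ such that for every $i$ there is $u_i\in\mathbb F(x,y)$ with $$D_x^i(H)=D_y(u_iT)+r_iT,$$ and each $r_i$ has the form $r_i=q_i/b+v_i/k_2$ with $q_i\in\mathbb F(x)[y]$, $\deg_y q_i<\deg_y b$ and $v_i\in\mathcal N_K$. Moreover: (i) A nonzero operator $L=\sum_{i=0}^{\rho}e_iD_x^i$ with $e_i\in\mathbb F(x)$ is a telescoper for $H$ if and only if $\sum_{i=0}^{\rho}e_ir_i=0$. (ii) A minimal telescoper for $H$ exists,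 and every minimal telescoper has order at most $\deg_y(b)+\max(\deg_y(k_1),\deg_y(k_2)-1)$, where $\deg_y(0)$ is read as $0$ in this bound (this only matters when $K=0$). -/

import Mathlib

open Polynomial

noncomputable section

namespace HyperexpTelescoping

section RationalFunctions

variable {R E : Type*} [CommRing R] [Field E] [Algebra R E]

theorem exists_eq_div (f : RatFunc E) : ∃ p q : E[X], q ≠ 0 ∧
    f = algebraMap E[X] (RatFunc E) p / algebraMap E[X] (RatFunc E) q :=
  ⟨f.num, f.denom, f.denom_ne_zero, (RatFunc.num_div_denom f).symm⟩

/-- The quotient-rule value `(δ p * q - p * δ q) / q ^ 2` for `f = p / q` in lowest terms. -/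
def quotientRule (δ : Derivation R E[X] E[X]) (f : RatFunc E) : RatFunc E :=
  algebraMap E[X] (RatFunc E) (δ f.num * f.denom - f.num * δ f.denom) /
    algebraMap E[X] (RatFunc E) f.denom ^ 2

theorem quotientRule_div (δ : Derivation R E[X] E[X]) (p q : E[X]) (hq : q ≠ 0) :
    quotientRule δ (algebraMap E[X] (RatFunc E) p / algebraMap E[X] (RatFunc E) q) =
      algebraMap E[X] (RatFunc E) (δ p * q - p * δ q) / algebraMap E[X] (RatFunc E) q ^ 2 := by
  set f : RatFunc E := algebraMap E[X] (RatFunc E) p / algebraMap E[X] (RatFunc E) q with hf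
  have hd : f.denom ≠ 0 := f.denom_ne_zero
  have hd' : algebraMap E[X] (RatFunc E) f.denom ≠ 0 := RatFunc.algebraMap_ne_zero hd
  have hq' : algebraMap E[X] (RatFunc E) q ≠ 0 := RatFunc.algebraMap_ne_zero hq
  have h0 : f.num * q = p * f.denom := by
    have h1 := RatFunc.num_div_denom f
    rw [hf] at h1
    rw [← hf, div_eq_div_iff hd' hq'] at h1
    exact RatFunc.algebraMap_injective E (by simpa only [map_mul] using h1)
  have h2 : δ f.num * q + f.num * δ q = δ p * f.denom + p * δ f.denom := by
    have := congrArg δ h0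
    simp only [Derivation.leibniz, smul_eq_mul] at this
    linear_combination this
  unfold quotientRule
  rw [div_eq_div_iff (pow_ne_zero 2 hd') (pow_ne_zero 2 hq')]
  simp only [← map_pow, ← map_mul]
  congr 1
  linear_combination (q * f.denom) * h2 - (q * δ f.denom + f.denom * δ q) * h0

theorem quotientRule_add (δ : Derivation R E[X] E[X]) (f g : RatFunc E) :
    quotientRule δ (f + g) = quotientRule δ f + quotientRule δ g := by
  obtain ⟨p, q, hq, rfl⟩ := exists_eq_div f
  obtain ⟨r, s, hs, rfl⟩ := exists_eq_div g
  have hq' := RatFunc.algebraMap_ne_zero hq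
  have hs' := RatFunc.algebraMap_ne_zero hs
  rw [div_add_div _ _ hq' hs', ← map_mul, ← map_mul, ← map_mul, ← map_add,
    quotientRule_div δ _ _ (mul_ne_zero hq hs), quotientRule_div δ _ _ hq,
    quotientRule_div δ _ _ hs]
  simp only [Derivation.leibniz, map_add, map_sub, map_mul, smul_eq_mul]
  field_simp
  ring

theorem quotientRule_mul (δ : Derivation R E[X] E[X]) (f g : RatFunc E) :
    quotientRule δ (f * g) = f * quotientRule δ g + g * quotientRule δ f := by
  obtain ⟨p, q, hq, rfl⟩ := exists_eq_div f
  obtain ⟨r, s, hs, rfl⟩ := exists_eq_div g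
  have hq' := RatFunc.algebraMap_ne_zero hq
  have hs' := RatFunc.algebraMap_ne_zero hs
  rw [div_mul_div_comm, ← map_mul, ← map_mul,
    quotientRule_div δ _ _ (mul_ne_zero hq hs), quotientRule_div δ _ _ hq,
    quotientRule_div δ _ _ hs]
  simp only [Derivation.leibniz, map_add, map_sub, map_mul, smul_eq_mul]
  field_simp
  ring

theorem quotientRule_smul (δ : Derivation R E[X] E[X]) (c : R) (f : RatFunc E) :
    quotientRule δ (c • f) = c • quotientRule δ f := by
  have hc : quotientRule δ (algebraMap E[X] (RatFunc E) (algebraMap R E[X] c)) = 0 := by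
    have h := quotientRule_div δ (algebraMap R E[X] c) 1 one_ne_zero
    rw [map_one, div_one] at h
    rw [h, Derivation.map_algebraMap, Derivation.map_one_eq_zero]
    simp only [zero_mul, mul_zero, sub_zero, map_zero, zero_div]
  rw [Algebra.smul_def, Algebra.smul_def, IsScalarTower.algebraMap_apply R E[X] (RatFunc E),
    quotientRule_mul, hc, mul_zero, add_zero]

/-- The extension of a derivation of `E[y]` to the field of rational functions `E(y)`. -/
def extendToRatFunc (δ : Derivation R E[X] E[X]) : Derivation R (RatFunc E) (RatFunc E) :=
  Derivation.mk'
    { toFun := quotientRule δ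
      map_add' := quotientRule_add δ
      map_smul' := quotientRule_smul δ }
    (quotientRule_mul δ)

/-- The coefficientwise extension of a derivation of `E` to `E[y]` (so `y` is mapped to `0`). -/
def coeffDeriv (d : Derivation R E E) : Derivation R E[X] E[X] :=
  PolynomialModule.equivPolynomialSelf.compDer d.mapCoeffs

theorem coeffDeriv_monomial (d : Derivation R E E) (n : ℕ) (a : E) :
    coeffDeriv d (monomial n a) = monomial n (d a) := by
  ext i
  change d ((monomial n a).coeff i) = _
  simp only [coeff_monomial]
  split_ifs <;> simp

/-- The usual derivation `d/dy` on `E(y)`. -/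
def ratDeriv (E : Type*) [Field E] : Derivation E (RatFunc E) (RatFunc E) :=
  extendToRatFunc Polynomial.derivative'

/-- `K = a / b` (in lowest terms) is differential-reduced:
`gcd (b, a - i * b') = 1` for every integer `i`. -/
def IsDifferentialReduced (K : RatFunc E) : Prop :=
  ∀ i : ℤ, IsCoprime K.denom (K.num - (i : E[X]) * derivative K.denom)

/-- `(K, S)` is a differential rational canonical form of `f`: `K` is a kernel and `S` a shell
of `f`. -/
structure IsKernelShell (f K S : RatFunc E) : Prop where
  reduced : IsDifferentialReduced K
  shell_ne_zero : S ≠ 0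
  coprime : IsCoprime S.denom K.denom
  eq_add_logDeriv : f = K + ratDeriv E S / S

/-- `b` is a squarefree part of `p`: it is squarefree and has the same irreducible factors. -/
def IsSquarefreePart (b p : E[X]) : Prop :=
  Squarefree b ∧ b ∣ p ∧ ∃ n : ℕ, p ∣ b ^ n

/-- The map for polynomial reduction with respect to `K = k₁ / k₂`: `p ↦ k₂ * p' + k₁ * p`. -/
def reductionMap (K : RatFunc E) : E[X] →ₗ[E] E[X] :=
  LinearMap.mulLeft E K.denom ∘ₗ derivative + LinearMap.mulLeft E K.num

/-- The subspace `M_K` for polynomial reduction with respect to `K`. -/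
def reductionSpace (K : RatFunc E) : Submodule E E[X] :=
  LinearMap.range (reductionMap K)

/-- A basis of a subspace of `E[y]` is an echelon basis if distinct elements have distinct
degrees. -/
structure IsEchelonBasis (M : Submodule E E[X]) (B : Set E[X]) : Prop where
  linearIndependent : LinearIndependent E ((↑) : B → E[X])
  span_eq : Submodule.span E B = M
  injOn : Set.InjOn natDegree B

/-- The standard complement `N_K` of `M_K`: the span of all monomials `y ^ ℓ` such that `ℓ` is not
the degree of an element of an echelon basis of `M_K`. These degrees are exactly the degrees of the
nonzero elements of `M_K`, see `IsEchelonBasis.image_natDegree`. -/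
def standardComplement (K : RatFunc E) : Submodule E E[X] :=
  Submodule.span E
    {m | ∃ l : ℕ, (∀ p ∈ reductionSpace K, p ≠ 0 → p.natDegree ≠ l) ∧ m = X ^ l}

theorem IsEchelonBasis.image_natDegree {M : Submodule E E[X]} {B : Set E[X]}
    (hB : IsEchelonBasis M B) : natDegree '' B = {l | ∃ p ∈ M, p ≠ 0 ∧ p.natDegree = l} := by
  ext l
  simp only [Set.mem_image, Set.mem_ofPred_eq]
  constructor
  · rintro ⟨p, hp, rfl⟩
    refine ⟨p, hB.span_eq ▸ Submodule.subset_span hp, ?_, rfl⟩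
    exact hB.linearIndependent.ne_zero ⟨p, hp⟩
  · rintro ⟨p, hp, hp0, rfl⟩
    rw [← hB.span_eq, Submodule.mem_span_set] at hp
    obtain ⟨c, hc, rfl⟩ := hp
    have hdeg : ∀ f ∈ c.support, (c f • f).degree = f.degree := fun f hf => by
      rw [smul_eq_C_mul, degree_C_mul (Finsupp.mem_support_iff.1 hf)]
    have hsum : (c.sum fun f a => a • f).degree = c.support.sup fun f => (c f • f).degree := by
      refine degree_sum_eq_of_disjoint _ _ ?_
      rintro f ⟨hf, -⟩ f' ⟨hf', -⟩ hne heq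
      simp only [Function.comp_apply] at heq
      rw [hdeg f hf, hdeg f' hf'] at heq
      exact hne (hB.injOn (hc hf) (hc hf') (natDegree_eq_natDegree heq))
    have hne : c.support.Nonempty := by
      rw [Finset.nonempty_iff_ne_empty]
      intro h
      exact hp0 (by simp [Finsupp.sum, h])
    obtain ⟨f, hf, hfe⟩ := Finset.exists_mem_eq_sup c.support hne fun f => (c f • f).degree
    refine ⟨f, hc hf, natDegree_eq_natDegree ?_⟩
    rw [hsum, hfe, hdeg f hf]

/-- `r` is a residual form with respect to `K = k₁ / k₂`: `r = q / b + v / k₂` with `b` squarefree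
and coprime to `k₂`, `deg q < deg b`, and `v` in the standard complement. -/
def IsResidualForm (K r : RatFunc E) : Prop :=
  ∃ q b v : E[X], Squarefree b ∧ IsCoprime b K.denom ∧ q.degree < b.degree ∧
    v ∈ standardComplement K ∧
    r = algebraMap E[X] (RatFunc E) q / algebraMap E[X] (RatFunc E) b +
      algebraMap E[X] (RatFunc E) v / algebraMap E[X] (RatFunc E) K.denom

end RationalFunctions

section Bivariate

variable {F : Type*} [Field F]

/-- The derivation `∂/∂x` on `F(x, y) = F(x)(y)`. -/
def partialX (F : Type*) [Field F] :
    Derivation F (RatFunc (RatFunc F)) (RatFunc (RatFunc F)) :=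
  extendToRatFunc (coeffDeriv (ratDeriv F))

theorem partialX_C (a : RatFunc F) :
    partialX F (RatFunc.C a) = RatFunc.C (ratDeriv F a) := by
  have h := quotientRule_div (coeffDeriv (ratDeriv F)) (C a) 1 one_ne_zero
  rw [map_one, div_one, RatFunc.algebraMap_C] at h
  change quotientRule (coeffDeriv (ratDeriv F)) (RatFunc.C a) = _
  rw [h, ← monomial_zero_left, coeffDeriv_monomial, Derivation.map_one_eq_zero]
  simp [RatFunc.algebraMap_C]

/-- The derivation `∂/∂y` on `F(x, y) = F(x)(y)`. -/
def partialY (F : Type*) [Field F] :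
    Derivation (RatFunc F) (RatFunc (RatFunc F)) (RatFunc (RatFunc F)) :=
  ratDeriv (RatFunc F)

/-- `Φ` with the commuting derivations `Dx`, `Dy` is a differential field extension of
`F(x, y)` with `∂/∂x`, `∂/∂y`. -/
structure IsDifferentialExtension {Φ : Type*} [Field Φ] [Algebra (RatFunc (RatFunc F)) Φ]
    (Dx Dy : Derivation ℤ Φ Φ) : Prop where
  comm : ∀ a : Φ, Dx (Dy a) = Dy (Dx a)
  extends_x : ∀ r : RatFunc (RatFunc F), Dx (algebraMap _ Φ r) = algebraMap _ Φ (partialX F r)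
  extends_y : ∀ r : RatFunc (RatFunc F), Dy (algebraMap _ Φ r) = algebraMap _ Φ (partialY F r)

/-- The underlying set of the ring `F(x)⟨D_x⟩` of differential operators: the polynomial with
coefficients `e_i` stands for `∑ e_i D_x ^ i` (coefficients on the left). The commutative
product of polynomials is not the product of operators; that one is `comp` below. -/
abbrev DiffOp (F : Type*) [Field F] : Type _ := (RatFunc F)[X]

/-- The product `L M` of operators, determined by `D_x M = ∑ (e_i' D_x ^ i + e_i D_x ^ (i + 1))` for
`M = ∑ e_i D_x ^ i`. -/
def DiffOp.comp (L M : DiffOp F) : DiffOp F :=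
  L.sum fun i e => C e * (fun N : DiffOp F => coeffDeriv (ratDeriv F) N + X * N)^[i] M

/-- The order of an operator. -/
def DiffOp.order (L : DiffOp F) : ℕ := L.natDegree

variable {Φ : Type*} [Field Φ] [Algebra (RatFunc (RatFunc F)) Φ]

/-- The action `L(h) = ∑ e_i D_x ^ i (h)`. -/
def DiffOp.apply (Dx : Derivation ℤ Φ Φ) (L : DiffOp F) (h : Φ) : Φ :=
  L.sum fun i e => algebraMap (RatFunc (RatFunc F)) Φ (RatFunc.C e) * Dx^[i] h

def DiffOp.applyHom (Dx : Derivation ℤ Φ Φ) (h : Φ) : DiffOp F →+ Φ where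
  toFun L := L.apply Dx h
  map_zero' := Polynomial.sum_zero_index _
  map_add' p q := Polynomial.sum_add_index p q _ (fun i => by simp)
    (fun i a b => by rw [map_add, map_add, add_mul])

theorem DiffOp.apply_monomial (Dx : Derivation ℤ Φ Φ) (h : Φ) (n : ℕ) (a : RatFunc F) :
    DiffOp.apply Dx (monomial n a) h =
      algebraMap (RatFunc (RatFunc F)) Φ (RatFunc.C a) * Dx^[n] h :=
  Polynomial.sum_monomial_index _ _ (by simp)

/-- The product of operators acts as the composition of the actions. -/
theorem DiffOp.apply_comp {Dx Dy : Derivation ℤ Φ Φ}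
    (hΦ : IsDifferentialExtension (F := F) Dx Dy) (L M : DiffOp F) (h : Φ) :
    (L.comp M).apply Dx h = L.apply Dx (M.apply Dx h) := by
  have happ : ∀ L : DiffOp F, L.apply Dx h = applyHom Dx h L := fun _ => rfl
  have hC : ∀ (e : RatFunc F) (N : DiffOp F), DiffOp.apply Dx (C e * N) h =
      algebraMap (RatFunc (RatFunc F)) Φ (RatFunc.C e) * N.apply Dx h := by
    intro e N
    induction N using Polynomial.induction_on' with
    | add p q hp hq =>
      simp only [happ] at hp hq ⊢
      rw [mul_add, map_add, map_add, hp, hq, mul_add]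
    | monomial n a => rw [C_mul_monomial, apply_monomial, apply_monomial, map_mul, map_mul, mul_assoc]
  have hD : ∀ N : DiffOp F, DiffOp.apply Dx (coeffDeriv (ratDeriv F) N + X * N) h =
      Dx (N.apply Dx h) := by
    intro N
    induction N using Polynomial.induction_on' with
    | add p q hp hq =>
      simp only [happ] at hp hq ⊢
      rw [map_add (coeffDeriv (ratDeriv F)), mul_add, add_add_add_comm, map_add, hp, hq, map_add,
        map_add]
    | monomial n a =>
      rw [X_mul_monomial, coeffDeriv_monomial, happ, map_add, ← happ, ← happ, apply_monomial,
        apply_monomial, apply_monomial, Derivation.leibniz, hΦ.extends_x, partialX_C,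
        Function.iterate_succ_apply']
      simp only [smul_eq_mul]
      ring
  have hDi : ∀ (i : ℕ) (N : DiffOp F),
      DiffOp.apply Dx ((fun N : DiffOp F => coeffDeriv (ratDeriv F) N + X * N)^[i] N) h =
        Dx^[i] (N.apply Dx h) := by
    intro i
    induction i with
    | zero => intro N; rfl
    | succ i ih => intro N; rw [Function.iterate_succ_apply, ih, hD, Function.iterate_succ_apply]
  rw [happ, comp, Polynomial.sum, map_sum]
  simp only [← happ, hC, hDi]
  rfl

variable (F) in
/-- A nonzero element of `Φ` is hyperexponential over `F(x, y)` if both of its logarithmic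
derivatives lie in `F(x, y)`. -/
def IsHyperexponential (Dx Dy : Derivation ℤ Φ Φ) (H : Φ) : Prop :=
  H ≠ 0 ∧ (∃ f : RatFunc (RatFunc F), Dx H / H = algebraMap _ Φ f) ∧
    ∃ g : RatFunc (RatFunc F), Dy H / H = algebraMap _ Φ g

/-- `L` is a telescoper for `H`: a nonzero operator with `L(H) = D_y(G)` for some
hyperexponential `G`. -/
def IsTelescoper (Dx Dy : Derivation ℤ Φ Φ) (H : Φ) (L : DiffOp F) : Prop :=
  L ≠ 0 ∧ ∃ G : Φ, IsHyperexponential F Dx Dy G ∧ L.apply Dx H = Dy G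

/-- `L` is a minimal telescoper for `H`: a telescoper that generates the left ideal of all
telescopers. -/
def IsMinimalTelescoper (Dx Dy : Derivation ℤ Φ Φ) (H : Φ) (L : DiffOp F) : Prop :=
  IsTelescoper Dx Dy H L ∧ ∀ L', IsTelescoper Dx Dy H L' → ∃ Q : DiffOp F, L' = Q.comp L

/-- The sequence `r` consists of residual forms with respect to `K` of the derivatives of `H`:
`D_x ^ i (H) = D_y (u_i T) + r_i T` for some rational functions `u_i`. -/
def IsResidualSequence (Dx Dy : Derivation ℤ Φ Φ) (H T : Φ) (K : RatFunc (RatFunc F))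
    (r : ℕ → RatFunc (RatFunc F)) : Prop :=
  ∀ i, IsResidualForm K (r i) ∧ ∃ u : RatFunc (RatFunc F),
    Dx^[i] H = Dy (algebraMap _ Φ u * T) + algebraMap _ Φ (r i) * T

end Bivariate

end HyperexpTelescoping

end

noncomputable section

namespace HyperexpTelescoping

/-! ### The twisted derivation `u ↦ u' + K u` -/

section Univariate

variable {E : Type*} [Field E]

/-! Write `E = F(x)`. Since `D_y T = K T`, `D_y` acts on rational multiples of `T` as the twisted
derivation `u ↦ u' + K u` on `E(y)`, so the theorem reduces to linear algebra over `E` modulo the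
image of this map.

Residual forms are normal forms modulo that image. A residual form in the image is zero
(`IsResidualForm.eq_zero`): differential-reducedness and simple poles away from `k₂` force the
preimage to be a polynomial, and `M_K ∩ N_K = 0` does the rest. Since differences of residual forms
are residual forms, uniqueness follows. Conversely, lowering pole orders at `k₂`, Hermite reduction
at `b` and polynomial reduction bring every fraction with denominator a power of `b k₂` to a form
over `b` (`exists_reduction`).

One `b` serves all derivatives of `H`: the derivations commute, so `f = D_x(T)/T` satisfies `D_y f =
D_x K` and has poles only at zeros of `k₂`. Hence `D_x^i(H) = s_i T` with every `s_i` having poles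
only at zeros of `b k₂` (`exists_iterate_eq`).

Now `L(H) = D_y(uT) + (∑ e_i r_i) T` for some `u`, which gives the telescoper criterion. The `r_i`
lie in a space of dimension at most `deg b + max(deg k₁, deg k₂ - 1)`, so a telescoper within the
bound exists. Right division makes the ideal of telescopers principal, and a right factor has no
larger order than the product. -/

theorem extendToRatFunc_div {R : Type*} [CommRing R] [Algebra R E]
    (δ : Derivation R E[X] E[X]) (p : E[X]) {q : E[X]} (hq : q ≠ 0) :
    extendToRatFunc δ (algebraMap E[X] (RatFunc E) p / algebraMap E[X] (RatFunc E) q) =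
      algebraMap E[X] (RatFunc E) (δ p * q - p * δ q) / algebraMap E[X] (RatFunc E) q ^ 2 :=
  quotientRule_div δ p q hq

theorem ratDeriv_div (p : E[X]) {q : E[X]} (hq : q ≠ 0) :
    ratDeriv E (algebraMap E[X] (RatFunc E) p / algebraMap E[X] (RatFunc E) q) =
      algebraMap E[X] (RatFunc E) (derivative p * q - p * derivative q) /
        algebraMap E[X] (RatFunc E) q ^ 2 :=
  extendToRatFunc_div derivative' p hq

/-- The map `u ↦ u' + K u`, conjugate to the derivation under multiplication by an element with
logarithmic derivative `K`. -/
def twistedDeriv (K : RatFunc E) : RatFunc E →ₗ[E] RatFunc E :=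
  (ratDeriv E : RatFunc E →ₗ[E] RatFunc E) + LinearMap.mulLeft E K

theorem twistedDeriv_apply (K u : RatFunc E) : twistedDeriv K u = ratDeriv E u + K * u := rfl

theorem reductionMap_apply (K : RatFunc E) (p : E[X]) :
    reductionMap K p = K.denom * derivative p + K.num * p := rfl

theorem twistedDeriv_div (K : RatFunc E) (p : E[X]) {q : E[X]} (hq : q ≠ 0) :
    twistedDeriv K (algebraMap E[X] (RatFunc E) p / algebraMap E[X] (RatFunc E) q) =
      algebraMap E[X] (RatFunc E)
        (K.denom * (derivative p * q - p * derivative q) + K.num * p * q) /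
      algebraMap E[X] (RatFunc E) (K.denom * q ^ 2) := by
  have hq' : algebraMap E[X] (RatFunc E) q ≠ 0 := RatFunc.algebraMap_ne_zero hq
  have hd : algebraMap E[X] (RatFunc E) K.denom ≠ 0 := RatFunc.algebraMap_ne_zero K.denom_ne_zero
  rw [twistedDeriv_apply, ratDeriv_div p hq]
  nth_rewrite 1 [← RatFunc.num_div_denom K]
  simp only [map_add, map_sub, map_mul, map_pow]
  field_simp

theorem twistedDeriv_algebraMap (K : RatFunc E) (p : E[X]) :
    twistedDeriv K (algebraMap E[X] (RatFunc E) p) =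
      algebraMap E[X] (RatFunc E) (reductionMap K p) / algebraMap E[X] (RatFunc E) K.denom := by
  have h := twistedDeriv_div K p one_ne_zero
  simpa [reductionMap_apply] using h

/-! ### Pole orders under differentiation -/

theorem not_dvd_derivative_of_irreducible [CharZero E] {p : E[X]} (hp : Irreducible p) :
    ¬ p ∣ derivative p := fun hd =>
  hp.not_isUnit (hp.separable.isUnit_of_dvd' dvd_rfl hd)

theorem not_dvd_natCast_add_one [CharZero E] {p : E[X]} (hp : Irreducible p) (n : ℕ) :
    ¬ p ∣ (n : E[X]) + 1 := by
  intro hd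
  refine hp.not_isUnit (isUnit_of_dvd_unit hd ?_)
  have : ((n : E[X]) + 1) = C ((n : E) + 1) := by simp
  rw [this]
  exact isUnit_C.2 (isUnit_iff_ne_zero.2 (Nat.cast_add_one_ne_zero n))

theorem derivative_pow_succ_mul (p q : E[X]) (n : ℕ) :
    derivative (p ^ (n + 1) * q) =
      p ^ n * (((n : E[X]) + 1) * derivative p * q + p * derivative q) := by
  rw [derivative_mul, derivative_pow_succ]
  simp only [map_add, map_natCast, map_one]
  ring

/-- If `A / B` is in lowest terms and `p` divides `B`, then `p` divides the denominator of the
derivative of `A / B`. -/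
theorem dvd_of_dvd_of_deriv_eq [CharZero E] {A B k W p : E[X]} (hAB : IsCoprime A B) (hB : B ≠ 0)
    (hp : Irreducible p) (hpB : p ∣ B)
    (h : k * (derivative A * B - A * derivative B) = W * B ^ 2) : p ∣ k := by
  obtain ⟨n, B₀, hB₀, rfl⟩ := WfDvdMonoid.max_power_factor hB hp
  have hpA : ¬ p ∣ A := fun hA => hp.not_isUnit (hAB.isUnit_of_dvd' hA hpB)
  rcases n with _ | n
  · exact absurd (by simpa using hpB) hB₀
  have hpp := not_dvd_derivative_of_irreducible hp
  have hn := not_dvd_natCast_add_one hp n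
  rw [derivative_pow_succ_mul] at h
  have h2 : k * (derivative A * (p * B₀) -
      A * (((n : E[X]) + 1) * derivative p * B₀ + p * derivative B₀)) =
      W * (p ^ (n + 2) * B₀ ^ 2) := by
    apply mul_left_cancel₀ (pow_ne_zero n hp.ne_zero)
    linear_combination h
  -- Modulo `p`, only the term that differentiates the factor `p ^ (n + 1)` survives.
  have h3 : p ∣ k * (A * (((n : E[X]) + 1) * derivative p * B₀)) :=
    ⟨k * (derivative A * B₀ - A * derivative B₀) - W * (p ^ (n + 1) * B₀ ^ 2), by
      linear_combination -h2⟩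
  simpa [hp.prime.dvd_mul, hpA, hpp, hn, hB₀] using h3

/-- The equation says that the twisted derivative of `A / B` for the kernel `k₁ / k₂` is `W / (c
k₂)`. Suppose `A / B` has a pole of order `n + 1` at `p`. If `p ∤ k₂`, the twisted derivative has a
pole of order `n + 2 ≥ 2`, too high for squarefree `c`. If `p ∣ k₂`, the leading coefficient
involves `k₁ - (n + 1) k₂'`, which is nonzero modulo `p` by differential-reducedness, so the pole
order exceeds that of `1 / k₂`; and `p ∤ c`. -/
theorem isUnit_of_simple_poles [CharZero E] {A B c W k₁ k₂ : E[X]} (hAB : IsCoprime A B)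
    (hB : B ≠ 0) (hc : Squarefree c) (hck : IsCoprime c k₂)
    (hred : ∀ i : ℤ, IsCoprime k₂ (k₁ - (i : E[X]) * derivative k₂))
    (h : c * (k₂ * (derivative A * B - A * derivative B) + k₁ * A * B) = W * B ^ 2) :
    IsUnit B := by
  by_contra hu
  obtain ⟨p, hp, hpB⟩ := WfDvdMonoid.exists_irreducible_factor hu hB
  obtain ⟨n, B₀, hB₀, rfl⟩ := WfDvdMonoid.max_power_factor hB hp
  have hpA : ¬ p ∣ A := fun hA => hp.not_isUnit (hAB.isUnit_of_dvd' hA hpB)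
  rcases n with _ | n
  · exact absurd (by simpa using hpB) hB₀
  have hpp := not_dvd_derivative_of_irreducible hp
  have hn := not_dvd_natCast_add_one hp n
  rw [derivative_pow_succ_mul] at h
  have h2 : c * (k₂ * (derivative A * (p * B₀) -
      A * (((n : E[X]) + 1) * derivative p * B₀ + p * derivative B₀)) + k₁ * A * (p * B₀)) =
      W * (p ^ (n + 2) * B₀ ^ 2) := by
    apply mul_left_cancel₀ (pow_ne_zero n hp.ne_zero)
    linear_combination h
  have h3 : p ∣ c * (k₂ * (A * (((n : E[X]) + 1) * derivative p * B₀))) :=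
    ⟨c * (k₂ * (derivative A * B₀ - A * derivative B₀) + k₁ * A * B₀) -
      W * (p ^ (n + 1) * B₀ ^ 2), by linear_combination -h2⟩
  have h4 : p ∣ c ∨ p ∣ k₂ := by simpa [hp.prime.dvd_mul, hpA, hpp, hn, hB₀] using h3
  by_cases hpk : p ∣ k₂
  · have hpc : ¬ p ∣ c := fun h => hp.not_isUnit (hck.isUnit_of_dvd' h hpk)
    obtain ⟨k₃, rfl⟩ := hpk
    have h5 : c * (k₃ * (derivative A * (p * B₀) -
        A * (((n : E[X]) + 1) * derivative p * B₀ + p * derivative B₀)) + k₁ * A * B₀) =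
        W * (p ^ (n + 1) * B₀ ^ 2) := by
      apply mul_left_cancel₀ hp.ne_zero
      linear_combination h2
    have h6 : p ∣ c * A * B₀ * (k₁ - ((n : E[X]) + 1) * derivative p * k₃) :=
      ⟨W * (p ^ n * B₀ ^ 2) - c * k₃ * (derivative A * B₀ - A * derivative B₀), by
        linear_combination h5⟩
    have h7 : p ∣ k₁ - ((n : E[X]) + 1) * derivative p * k₃ := by
      simpa [hp.prime.dvd_mul, hpA, hpc, hB₀] using h6
    -- The index is the pole order at `p`; modulo `p`, the derivative of `p * k₃` is `p' * k₃`.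
    have h8 := hred (n + 1)
    refine hp.not_isUnit (h8.isUnit_of_dvd' (dvd_mul_right _ _) ?_)
    have h9 : k₁ - (((n + 1 : ℤ)) : E[X]) * derivative (p * k₃) =
        k₁ - ((n : E[X]) + 1) * derivative p * k₃ - p * (((n : E[X]) + 1) * derivative k₃) := by
      rw [derivative_mul]; push_cast; ring
    rw [h9]
    exact dvd_sub h7 (dvd_mul_right _ _)
  · obtain ⟨c₀, rfl⟩ := h4.resolve_right hpk
    have hpc : ¬ p ∣ c₀ := fun h => hp.not_isUnit (hc p (mul_dvd_mul_left p h))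
    have h5 : p ∣ c₀ * (k₂ * (A * (((n : E[X]) + 1) * derivative p * B₀))) :=
      ⟨c₀ * (k₂ * (derivative A * B₀ - A * derivative B₀) + k₁ * A * B₀) -
        W * (p ^ n * B₀ ^ 2), by
          apply mul_left_cancel₀ hp.ne_zero
          linear_combination -h2⟩
    simp [hp.prime.dvd_mul, hpA, hpp, hn, hB₀, hpc, hpk] at h5

/-! ### Polynomial reduction and the standard complement -/

theorem standardComplement_coeff {K : RatFunc E} {v : E[X]} (hv : v ∈ standardComplement K) {l : ℕ}
    (hl : v.coeff l ≠ 0) : ∀ p ∈ reductionSpace K, p ≠ 0 → p.natDegree ≠ l := by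
  revert hl
  unfold standardComplement at hv
  induction hv using Submodule.span_induction with
  | mem x h =>
    obtain ⟨m, hm, rfl⟩ := h
    intro hl
    rw [coeff_X_pow] at hl
    obtain rfl : l = m := by by_contra hne; simp [hne] at hl
    exact hm
  | zero => intro h; simp at h
  | add x y _ _ hx hy =>
    intro h
    by_cases h0 : x.coeff l = 0
    · exact hy (by simpa [h0] using h)
    · exact hx h0
  | smul a x _ hx =>
    intro h
    exact hx (by intro h0; simp [h0] at h)

theorem disjoint_reductionSpace (K : RatFunc E) :
    Disjoint (reductionSpace K) (standardComplement K) := by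
  rw [Submodule.disjoint_def]
  intro p hp hv
  by_contra hp0
  exact standardComplement_coeff hv (l := p.natDegree) (by simpa using hp0) p hp hp0 rfl

/-- Every degree is attained either by a nonzero element of `M_K` or by a monomial of `N_K`, so the
leading term can always be cancelled. -/
theorem exists_add_standardComplement (K : RatFunc E) (w : E[X]) :
    ∃ p v : E[X], v ∈ standardComplement K ∧ w = reductionMap K p + v := by
  suffices h : w ∈ reductionSpace K ⊔ standardComplement K by
    obtain ⟨_, ⟨p, rfl⟩, v, hv, rfl⟩ := Submodule.mem_sup.1 h
    exact ⟨p, v, hv, rfl⟩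
  induction hn : w.natDegree using Nat.strong_induction_on generalizing w with
  | _ n ih =>
  subst hn
  have key : ∀ g ∈ reductionSpace K ⊔ standardComplement K, g ≠ 0 → g.natDegree = w.natDegree →
      w ∈ reductionSpace K ⊔ standardComplement K := by
    intro g hg hg0 hdeg
    have hlc : g.leadingCoeff ≠ 0 := leadingCoeff_ne_zero.2 hg0
    set a := w.leadingCoeff / g.leadingCoeff
    have hw : w = (w - a • g) + a • g := by ring
    have hmem : a • g ∈ reductionSpace K ⊔ standardComplement K := Submodule.smul_mem _ _ hg
    -- Constants are treated apart: cancelling the leading term gives `0`, whose `natDegree` is not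
    -- smaller.
    by_cases h0 : w.natDegree = 0
    · have : w = a • g := by
        rw [eq_C_of_natDegree_eq_zero h0, eq_C_of_natDegree_eq_zero (hdeg.trans h0)]
        have : a * g.coeff 0 = w.coeff 0 := by
          have h1 : g.leadingCoeff = g.coeff 0 := by rw [leadingCoeff, hdeg, h0]
          have h2 : w.leadingCoeff = w.coeff 0 := by rw [leadingCoeff, h0]
          rw [← h1, ← h2]; exact div_mul_cancel₀ _ hlc
        rw [smul_C, smul_eq_mul, this]
      rw [this]; exact hmem
    rw [hw]
    refine Submodule.add_mem _ (ih _ ?_ _ rfl) hmem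
    refine lt_of_le_of_ne ?_ ?_
    · refine (natDegree_sub_le _ _).trans (max_le le_rfl ?_)
      exact (natDegree_smul_le _ _).trans hdeg.le
    · intro heq
      have hc : (w - a • g).coeff w.natDegree = 0 := by
        rw [coeff_sub, coeff_smul, smul_eq_mul, ← hdeg, coeff_natDegree]
        rw [div_mul_cancel₀ _ hlc, hdeg, coeff_natDegree, sub_self]
      rw [← heq, coeff_natDegree, leadingCoeff_eq_zero] at hc
      rw [hc, natDegree_zero] at heq
      exact h0 heq.symm
  by_cases hex : ∃ p ∈ reductionSpace K, p ≠ 0 ∧ p.natDegree = w.natDegree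
  · obtain ⟨g, hg, hg0, hdeg⟩ := hex
    exact key g (Submodule.mem_sup_left hg) hg0 hdeg
  · push Not at hex
    refine key (X ^ w.natDegree) (Submodule.mem_sup_right (Submodule.subset_span ⟨_, ?_, rfl⟩))
      (pow_ne_zero _ X_ne_zero) (natDegree_X_pow _)
    exact hex

/-- A residual form in the image of the twisted derivation vanishes. -/
theorem IsResidualForm.eq_zero [CharZero E] {K r u : RatFunc E} (hK : IsDifferentialReduced K)
    (hr : IsResidualForm K r) (h : twistedDeriv K u = r) : r = 0 := by
  obtain ⟨q, c, v, hc, hck, hq, hv, rfl⟩ := hr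
  have hk' : algebraMap E[X] (RatFunc E) K.denom ≠ 0 := RatFunc.algebraMap_ne_zero K.denom_ne_zero
  have hc' : algebraMap E[X] (RatFunc E) c ≠ 0 := RatFunc.algebraMap_ne_zero hc.ne_zero
  have hB0 := u.denom_ne_zero
  have hB' : algebraMap E[X] (RatFunc E) u.denom ≠ 0 := RatFunc.algebraMap_ne_zero hB0
  have h1 := h
  rw [← RatFunc.num_div_denom u, twistedDeriv_div K _ hB0, div_add_div _ _ hc' hk',
    div_eq_div_iff (RatFunc.algebraMap_ne_zero
      (mul_ne_zero K.denom_ne_zero (pow_ne_zero 2 hB0))) (mul_ne_zero hc' hk')] at h1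
  simp only [← map_mul, ← map_add] at h1
  have h2 := RatFunc.algebraMap_injective E h1
  -- Over the common denominator `c k₂`, the residual form has numerator `q k₂ + c v`.
  have hunit : IsUnit u.denom := by
    refine isUnit_of_simple_poles u.isCoprime_num_denom hB0 hc hck hK
      (W := q * K.denom + c * v) ?_
    apply mul_left_cancel₀ K.denom_ne_zero
    linear_combination h2
  have hB1 : u.denom = 1 := u.monic_denom.eq_one_of_isUnit hunit
  obtain ⟨p, rfl⟩ : ∃ p, u = algebraMap E[X] (RatFunc E) p := by
    refine ⟨u.num, ?_⟩
    conv_lhs => rw [← RatFunc.num_div_denom u, hB1, map_one, div_one]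
  rw [twistedDeriv_algebraMap, div_add_div _ _ hc' hk', div_eq_div_iff hk' (mul_ne_zero hc' hk')]
    at h
  simp only [← map_mul, ← map_add] at h
  have h3 := RatFunc.algebraMap_injective E h
  have h4 : c * (reductionMap K p - v) = q * K.denom := by
    apply mul_left_cancel₀ K.denom_ne_zero
    linear_combination h3
  have hq0 : q = 0 := eq_zero_of_dvd_of_degree_lt
    (hck.dvd_of_dvd_mul_right ⟨_, h4.symm⟩) hq
  rw [hq0, zero_mul] at h4
  have h5 : v = reductionMap K p :=
    (sub_eq_zero.1 ((mul_eq_zero.1 h4).resolve_left hc.ne_zero)).symm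
  have h6 : v = 0 := (Submodule.disjoint_def.1 (disjoint_reductionSpace K)) v
    (h5 ▸ ⟨p, rfl⟩) hv
  simp [hq0, h6]

end Univariate

/-! ### Reduction to residual forms -/

section ResidualForms

variable {E : Type*} [Field E]

/-- The map `(q, v) ↦ q / b + v / k₂`. -/
def formMap (K : RatFunc E) (b : E[X]) : E[X] × E[X] →ₗ[E] RatFunc E :=
  (LinearMap.mulRight E (algebraMap E[X] (RatFunc E) b)⁻¹ ∘ₗ
    (IsScalarTower.toAlgHom E E[X] (RatFunc E)).toLinearMap).coprod
  (LinearMap.mulRight E (algebraMap E[X] (RatFunc E) K.denom)⁻¹ ∘ₗ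
    (IsScalarTower.toAlgHom E E[X] (RatFunc E)).toLinearMap)

/-- The forms `q / b + v / k₂` with `deg q < deg b` and `v` in the standard complement. -/
def residualForms (K : RatFunc E) (b : E[X]) : Submodule E (RatFunc E) :=
  LinearMap.range (formMap K b ∘ₗ
    (degreeLT E b.natDegree).subtype.prodMap (standardComplement K).subtype)

theorem mem_residualForms {K r : RatFunc E} {b : E[X]} (hb : b ≠ 0) :
    r ∈ residualForms K b ↔ ∃ q v : E[X], q.degree < b.degree ∧ v ∈ standardComplement K ∧
      r = algebraMap E[X] (RatFunc E) q / algebraMap E[X] (RatFunc E) b +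
        algebraMap E[X] (RatFunc E) v / algebraMap E[X] (RatFunc E) K.denom := by
  have h : ∀ q v : E[X], formMap K b (q, v) =
      algebraMap E[X] (RatFunc E) q / algebraMap E[X] (RatFunc E) b +
        algebraMap E[X] (RatFunc E) v / algebraMap E[X] (RatFunc E) K.denom := fun q v => by
    simp [formMap, div_eq_mul_inv]
  simp only [residualForms, LinearMap.mem_range, LinearMap.comp_apply, LinearMap.prodMap_apply,
    Submodule.subtype_apply, Prod.exists, Subtype.exists, mem_degreeLT, h, degree_eq_natDegree hb,
    exists_prop, eq_comm, exists_and_left]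

theorem isResidualForm_of_mem {K r : RatFunc E} {b : E[X]} (hb : Squarefree b)
    (hbK : IsCoprime b K.denom) (hr : r ∈ residualForms K b) : IsResidualForm K r := by
  obtain ⟨q, v, hq, hv, rfl⟩ := (mem_residualForms hb.ne_zero).1 hr
  exact ⟨q, b, v, hb, hbK, hq, hv, rfl⟩

theorem residualForms_mono (K : RatFunc E) {b c : E[X]} (hbc : b ∣ c) (hc : c ≠ 0) :
    residualForms K b ≤ residualForms K c := by
  intro r hr
  obtain ⟨d, rfl⟩ := hbc
  have hb : b ≠ 0 := left_ne_zero_of_mul hc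
  have hd : d ≠ 0 := right_ne_zero_of_mul hc
  have hb' := RatFunc.algebraMap_ne_zero hb
  have hd' := RatFunc.algebraMap_ne_zero hd
  obtain ⟨q, v, hq, hv, rfl⟩ := (mem_residualForms hb).1 hr
  refine (mem_residualForms hc).2 ⟨q * d, v, ?_, hv, ?_⟩
  · rw [degree_mul, degree_mul]
    exact WithBot.add_lt_add_right (degree_ne_bot.2 hd) hq
  · rw [map_mul, map_mul, mul_div_mul_right _ _ hd']

/-- The two squarefree denominators may differ; the radical of their product is a common squarefree
multiple, still coprime to `k₂`. -/
theorem IsResidualForm.sub {K r s : RatFunc E} (hr : IsResidualForm K r)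
    (hs : IsResidualForm K s) : IsResidualForm K (r - s) := by
  classical
  obtain ⟨q, c, v, hc, hck, hq, hv, hr⟩ := hr
  obtain ⟨q', c', v', hc', hck', hq', hv', hs⟩ := hs
  have h0 : c * c' ≠ 0 := mul_ne_zero hc.ne_zero hc'.ne_zero
  set b := UniqueFactorizationMonoid.radical (c * c') with hb
  have hcb : c ∣ b := (UniqueFactorizationMonoid.dvd_radical_iff hc.isRadical h0).2
    (dvd_mul_right _ _)
  have hcb' : c' ∣ b := (UniqueFactorizationMonoid.dvd_radical_iff hc'.isRadical h0).2
    (dvd_mul_left _ _)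
  have hbs : Squarefree b := UniqueFactorizationMonoid.squarefree_radical
  refine isResidualForm_of_mem hbs
    ((hck.mul_left hck').of_isCoprime_of_dvd_left UniqueFactorizationMonoid.radical_dvd_self)
    (sub_mem (residualForms_mono K hcb hbs.ne_zero ?_) (residualForms_mono K hcb' hbs.ne_zero ?_))
  · exact (mem_residualForms hc.ne_zero).2 ⟨q, v, hq, hv, hr⟩
  · exact (mem_residualForms hc'.ne_zero).2 ⟨q', v', hq', hv', hs⟩

/-- Reduction of the order of the poles at the denominator of the kernel. -/
theorem exists_reduction_kernel {K : RatFunc E} (hK : IsDifferentialReduced K)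
    {c : E[X]} (hc0 : c ≠ 0) (hcK : IsCoprime c K.denom) (M : ℕ) (a : E[X]) :
    ∃ (u : RatFunc E) (a' : E[X]),
      algebraMap E[X] (RatFunc E) a / algebraMap E[X] (RatFunc E) (c * K.denom ^ (M + 1)) =
      twistedDeriv K u +
      algebraMap E[X] (RatFunc E) a' / algebraMap E[X] (RatFunc E) (c * K.denom) := by
  induction M generalizing a with
  | zero => exact ⟨0, a, by simp⟩
  | succ M ih =>
    have hk0 := K.denom_ne_zero
    -- The twisted derivative of `w / k₂ ^ (M + 1)` has leading numerator `(k₁ - (M + 1) k₂') w`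
    -- over `k₂ ^ (M + 2)`. Inverting `c (k₁ - (M + 1) k₂')` modulo `k₂` gives the `w = β a` that
    -- cancels the top pole.
    obtain ⟨α, β, hαβ⟩ := (hcK.symm.mul_right (hK (M + 1)))
    obtain ⟨u, a', ha'⟩ := ih (α * a - c * derivative (β * a))
    refine ⟨algebraMap E[X] (RatFunc E) (β * a) /
      algebraMap E[X] (RatFunc E) (K.denom ^ (M + 1)) + u, a', ?_⟩
    have hq0 := pow_ne_zero (M + 1) hk0
    rw [map_add, add_assoc (twistedDeriv K _), ← ha', twistedDeriv_div K (β * a) hq0, div_add_div,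
      div_eq_div_iff]
    · simp only [← map_mul, ← map_add]
      congr 1
      rw [derivative_pow_succ]
      push_cast at hαβ
      simp only [map_add, map_natCast, map_one]
      linear_combination (-(a * c * K.denom ^ (3 * M + 4))) * hαβ
    all_goals simp [hk0, hc0]

/-- Hermite reduction. -/
theorem exists_reduction_squarefree [CharZero E] {K : RatFunc E} {b : E[X]} (hb : Squarefree b)
    (hbK : IsCoprime b K.denom) (m : ℕ) (a : E[X]) :
    ∃ (u : RatFunc E) (a' : E[X]),
      algebraMap E[X] (RatFunc E) a / algebraMap E[X] (RatFunc E) (b ^ (m + 1) * K.denom) =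
      twistedDeriv K u +
      algebraMap E[X] (RatFunc E) a' / algebraMap E[X] (RatFunc E) (b * K.denom) := by
  induction m generalizing a with
  | zero => exact ⟨0, a, by simp⟩
  | succ m ih =>
    have hk0 := K.denom_ne_zero
    have hb0 := hb.ne_zero
    have hsep : IsCoprime b (derivative b) := PerfectField.separable_iff_squarefree.2 hb
    have hu : IsUnit (C (-((m : E) + 1))) :=
      isUnit_C.2 (isUnit_iff_ne_zero.2 (neg_ne_zero.2 (Nat.cast_add_one_ne_zero m)))
    -- Differentiating `w / b ^ (m + 1)` produces `-(m + 1) b' w / b ^ (m + 2)`; the factor `-(m +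
    -- 1) b' k₂` is invertible modulo `b`.
    obtain ⟨α, β, hαβ⟩ := (isCoprime_mul_unit_left_right hu b _).2 (hsep.mul_right hbK)
    obtain ⟨u, a', ha'⟩ := ih (α * a - reductionMap K (β * a))
    refine ⟨algebraMap E[X] (RatFunc E) (β * a) /
      algebraMap E[X] (RatFunc E) (b ^ (m + 1)) + u, a', ?_⟩
    have hq0 := pow_ne_zero (m + 1) hb0
    rw [map_add, add_assoc (twistedDeriv K _), ← ha', twistedDeriv_div K (β * a) hq0, div_add_div,
      div_eq_div_iff]
    · simp only [← map_mul, ← map_add]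
      congr 1
      rw [derivative_pow_succ, reductionMap_apply]
      simp only [map_add, map_natCast, map_one, map_neg] at hαβ ⊢
      linear_combination (-(a * K.denom ^ 2 * b ^ (3 * m + 3))) * hαβ
    all_goals simp [hk0, hb0]

theorem exists_reduction [CharZero E] {K : RatFunc E} (hK : IsDifferentialReduced K) {b : E[X]}
    (hb : Squarefree b) (hbK : IsCoprime b K.denom) (n : ℕ) (a : E[X]) :
    ∃ u : RatFunc E, ∃ r ∈ residualForms K b,
      algebraMap E[X] (RatFunc E) a / algebraMap E[X] (RatFunc E) ((b * K.denom) ^ n) =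
      twistedDeriv K u + r := by
  have hk0 := K.denom_ne_zero
  have hb0 := hb.ne_zero
  have hk' := RatFunc.algebraMap_ne_zero hk0
  have hb' := RatFunc.algebraMap_ne_zero hb0
  -- Expanding by `b k₂` makes both exponents positive, which covers `n = 0`.
  obtain ⟨u₁, a₁, h₁⟩ := exists_reduction_kernel hK (pow_ne_zero (n + 1) hb0)
    (hbK.pow_left (m := n + 1)) n (a * (b * K.denom))
  obtain ⟨u₂, a₂, h₂⟩ := exists_reduction_squarefree hb hbK n a₁
  obtain ⟨α, β, hαβ⟩ := hbK
  -- Partial fractions split `a₂ / (b k₂)` as `β a₂ / b + α a₂ / k₂`. The quotient of `β a₂` by `b`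
  -- joins the part over `k₂`, where polynomial reduction applies.
  obtain ⟨p, v, hv, hw⟩ := exists_add_standardComplement K
    (α * a₂ + K.denom * ((β * a₂) / b))
  refine ⟨u₁ + (u₂ + algebraMap E[X] (RatFunc E) p), algebraMap E[X] (RatFunc E) ((β * a₂) % b) /
    algebraMap E[X] (RatFunc E) b + algebraMap E[X] (RatFunc E) v /
    algebraMap E[X] (RatFunc E) K.denom,
    (mem_residualForms hb0).2 ⟨_, _, EuclideanDomain.mod_lt _ hb0, hv, rfl⟩, ?_⟩
  have h₀ : algebraMap E[X] (RatFunc E) a / algebraMap E[X] (RatFunc E) ((b * K.denom) ^ n) =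
      algebraMap E[X] (RatFunc E) (a * (b * K.denom)) /
        algebraMap E[X] (RatFunc E) (b ^ (n + 1) * K.denom ^ (n + 1)) := by
    rw [← mul_pow, pow_succ, map_mul, map_mul _ ((b * K.denom) ^ n), mul_div_mul_right]
    exact RatFunc.algebraMap_ne_zero (mul_ne_zero hb0 hk0)
  have h₃ : a₂ = (β * a₂ % b) * K.denom + b * (reductionMap K p + v) := by
    rw [← hw]
    have := EuclideanDomain.div_add_mod (β * a₂) b
    linear_combination -a₂ * hαβ - K.denom * this
  rw [h₀, h₁, h₂, map_add, map_add, twistedDeriv_algebraMap]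
  nth_rewrite 1 [h₃]
  simp only [map_add, map_mul]
  field_simp
  ring

end ResidualForms

/-! ### Dimension of the space of residual forms -/

section Dimension

variable {E : Type*} [Field E]

/-- For constant `k₂`, compare the degrees of `p'` and `k₁ p`. Otherwise write `p = k₂ ^ m p₀` with
`k₂ ∤ p₀`: a kernel element gives `k₂ ∣ (k₁ + m k₂') p₀`, contradicting differential-reducedness at
the index `-m`. This fails for `K = 0`, where constants are in the kernel. -/
theorem reductionMap_injective [CharZero E] {K : RatFunc E} (hK : IsDifferentialReduced K)
    (hK0 : K ≠ 0) : Function.Injective (reductionMap K) := by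
  rw [← LinearMap.ker_eq_bot, LinearMap.ker_eq_bot']
  intro p hp
  rw [reductionMap_apply] at hp
  by_contra hp0
  have hn0 : K.num ≠ 0 := fun h => hK0 (RatFunc.num_eq_zero_iff.1 h)
  by_cases hu : IsUnit K.denom
  · rw [K.monic_denom.eq_one_of_isUnit hu, one_mul] at hp
    have h1 : (K.num * p).degree ≤ (derivative p).degree := by
      rw [eq_neg_of_add_eq_zero_right hp, degree_neg]
    have h2 : p.degree ≤ (K.num * p).degree := by
      rw [degree_mul]
      exact le_add_of_nonneg_left (zero_le_degree_iff.2 hn0)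
    exact absurd (h2.trans h1) (not_le.2 (degree_derivative_lt hp0))
  · obtain ⟨m, p₀, hp₀, rfl⟩ := WfDvdMonoid.max_power_factor' hp0 hu
    have h1 : m * derivative K.denom * p₀ + K.denom * derivative p₀ + K.num * p₀ = 0 := by
      apply (mul_eq_zero.1 (?_ : K.denom ^ m * _ = 0)).resolve_left
        (pow_ne_zero m K.denom_ne_zero)
      rcases m with _ | m
      · simpa using hp
      · rw [derivative_mul, derivative_pow_succ] at hp
        simp only [map_add, map_natCast, map_one] at hp
        push_cast
        linear_combination hp
    have h2 : K.denom ∣ (K.num - ((-m : ℤ) : E[X]) * derivative K.denom) * p₀ :=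
      ⟨-derivative p₀, by push_cast; linear_combination h1⟩
    exact hp₀ ((hK (-m)).dvd_of_dvd_mul_left h2)

theorem reductionMap_mem_degreeLT {K : RatFunc E} {n : ℕ} {p : E[X]} (hp : p ∈ degreeLT E n) :
    reductionMap K p ∈ degreeLT E (n + max K.num.natDegree (K.denom.natDegree - 1)) := by
  rw [reductionMap_apply]
  rcases eq_or_ne p 0 with rfl | hp0
  · simp
  have hn : p.natDegree < n := by
    rwa [mem_degreeLT, ← natDegree_lt_iff_degree_lt hp0] at hp
  have key : ∀ f : E[X],
      f.natDegree < n + max K.num.natDegree (K.denom.natDegree - 1) →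
      f ∈ degreeLT E (n + max K.num.natDegree (K.denom.natDegree - 1)) := by
    intro f hf
    rw [mem_degreeLT]
    exact degree_le_natDegree.trans_lt (by exact_mod_cast hf)
  refine add_mem ?_ (key _ ?_)
  · rcases Nat.eq_zero_or_pos p.natDegree with h0 | hpos
    · rw [derivative_of_natDegree_zero h0, mul_zero]
      exact zero_mem _
    · refine key _ ?_
      have h1 := natDegree_derivative_le p
      have h2 := natDegree_mul_le (p := K.denom) (q := derivative p)
      have := le_max_right K.num.natDegree (K.denom.natDegree - 1)
      omega
  · have h2 := natDegree_mul_le (p := K.num) (q := p)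
    have := le_max_left K.num.natDegree (K.denom.natDegree - 1)
    omega

theorem standardComplement_zero [CharZero E] : standardComplement (0 : RatFunc E) = ⊥ := by
  have h : reductionSpace (0 : RatFunc E) = ⊤ := by
    rw [eq_top_iff]
    rintro p -
    induction p using Polynomial.induction_on' with
    | add p q hp hq => exact add_mem hp hq
    | monomial n a =>
      refine ⟨monomial (n + 1) (a / ((n : E) + 1)), ?_⟩
      rw [reductionMap_apply]
      simp [div_mul_cancel₀ _ (Nat.cast_add_one_ne_zero (R := E) n)]
  have := disjoint_reductionSpace (0 : RatFunc E)
  rwa [h, top_disjoint] at this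

/-- Let `D` be the bound and `K ≠ 0`. The reduction map is injective and raises degrees by at most
`D`, so it sends polynomials of degree `< n` onto an `n`-dimensional space inside those of degree `<
n + D`. For large `n`, a finite-dimensional subspace of `N_K` lies there too and meets this image
trivially, which leaves it dimension at most `D`. For `K = 0`, `M_K` is everything because
differentiation is surjective. -/
theorem rank_standardComplement_le [CharZero E] {K : RatFunc E} (hK : IsDifferentialReduced K) :
    Module.rank E (standardComplement K) ≤
      ((max K.num.natDegree (K.denom.natDegree - 1) : ℕ) : Cardinal) := by
  rcases eq_or_ne K 0 with rfl | hK0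
  · rw [standardComplement_zero, rank_bot]
    exact zero_le
  refine rank_le fun s hs => ?_
  set D := max K.num.natDegree (K.denom.natDegree - 1)
  have hs' : LinearIndependent E (fun v : s => ((v : standardComplement K) : E[X])) :=
    hs.map' (standardComplement K).subtype (Submodule.ker_subtype _)
  set V := Submodule.span E (Set.range fun v : s => ((v : standardComplement K) : E[X])) with hV
  have hVN : V ≤ standardComplement K := by
    rw [hV, Submodule.span_le]
    rintro _ ⟨v, rfl⟩
    exact v.1.2
  set n := s.sup (fun v => (v : E[X]).natDegree) + 1
  have hVn : V ≤ degreeLT E (n + D) := by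
    rw [hV, Submodule.span_le]
    rintro _ ⟨v, rfl⟩
    rw [SetLike.mem_coe, mem_degreeLT]
    refine degree_le_natDegree.trans_lt ?_
    have := Finset.le_sup (f := fun v : standardComplement K => (v : E[X]).natDegree) v.2
    exact_mod_cast (by omega : (v : E[X]).natDegree < n + D)
  set W := (degreeLT E n).map (reductionMap K) with hW
  have hWn : W ≤ degreeLT E (n + D) := by
    rintro _ ⟨p, hp, rfl⟩
    exact reductionMap_mem_degreeLT hp
  have hWV : W ⊓ V = ⊥ := by
    refine ((disjoint_reductionSpace K).mono ?_ hVN).eq_bot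
    rintro _ ⟨p, -, rfl⟩
    exact ⟨p, rfl⟩
  have hdeg : ∀ m, Module.finrank E (degreeLT E m) = m := fun m => by
    rw [(degreeLTEquiv E m).finrank_eq, Module.finrank_fin_fun]
  have hfd : ∀ m, FiniteDimensional E (degreeLT E m) := fun m =>
    (degreeLTEquiv E m).symm.finiteDimensional
  have := hfd n
  have := hfd (n + D)
  have := Submodule.finiteDimensional_of_le hVn
  have := Submodule.finiteDimensional_of_le hWn
  have h1 : Module.finrank E W = n := by
    rw [hW, (Submodule.equivMapOfInjective _ (reductionMap_injective hK hK0) _).finrank_eq.symm,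
      hdeg]
  have h2 : Module.finrank E V = s.card := by
    rw [hV, finrank_span_eq_card hs', Fintype.card_coe]
  have h3 := Submodule.finrank_sup_add_finrank_inf_eq W V
  rw [hWV, finrank_bot, h1, h2] at h3
  have h4 := Submodule.finrank_mono (sup_le hWn hVn)
  rw [hdeg] at h4
  omega

theorem rank_residualForms_le [CharZero E] {K : RatFunc E} (hK : IsDifferentialReduced K)
    (b : E[X]) : Module.rank E (residualForms K b) ≤
      ((b.natDegree + max K.num.natDegree (K.denom.natDegree - 1) : ℕ) : Cardinal) := by
  rw [residualForms]
  refine (rank_range_le _).trans ?_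
  rw [rank_prod', (degreeLTEquiv E b.natDegree).rank_eq, rank_fin_fun, Nat.cast_add]
  exact add_le_add le_rfl (rank_standardComplement_le hK)

theorem exists_relation_of_mem_residualForms [CharZero E] {K : RatFunc E}
    (hK : IsDifferentialReduced K) (b : E[X]) (r : ℕ → RatFunc E)
    (hr : ∀ i, r i ∈ residualForms K b) :
    ∃ L : E[X], L ≠ 0 ∧
      L.natDegree ≤ b.natDegree + max K.num.natDegree (K.denom.natDegree - 1) ∧
      (L.sum fun i e => RatFunc.C e * r i) = 0 := by
  set ρ := b.natDegree + max K.num.natDegree (K.denom.natDegree - 1) with hρ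
  have hrank := rank_residualForms_le hK b
  rw [← hρ] at hrank
  have hfd : FiniteDimensional E (residualForms K b) :=
    Module.rank_lt_aleph0_iff.1 (hrank.trans_lt Cardinal.natCast_lt_aleph0)
  have hfin : Module.finrank E (residualForms K b) ≤ ρ := by
    rw [← Module.finrank_eq_rank] at hrank
    exact_mod_cast hrank
  obtain ⟨c, hc, i, hi⟩ := (Fintype.not_linearIndependent_iff (R := E)
    (v := fun i : Fin (ρ + 1) => (⟨r i, hr i⟩ : residualForms K b))).1 fun h => by
      have := h.fintype_card_le_finrank
      rw [Fintype.card_fin] at this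
      omega
  have hsum : ∀ f : Fin (ρ + 1) → E, (((degreeLTEquiv E (ρ + 1)).symm f : E[X]).sum
      fun i e => RatFunc.C e * r i) = ∑ i, RatFunc.C (f i) * r i := by
    intro f
    rw [← sum_fin (fun i e => RatFunc.C e * r i) (by simp)
      (mem_degreeLT.1 ((degreeLTEquiv E (ρ + 1)).symm f).2)]
    refine Finset.sum_congr rfl fun i _ => ?_
    congr 2
    exact congrFun ((degreeLTEquiv E (ρ + 1)).apply_symm_apply f) i
  refine ⟨(degreeLTEquiv E (ρ + 1)).symm c, ?_, ?_, ?_⟩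
  · intro h
    have h0 : (degreeLTEquiv E (ρ + 1)).symm c = 0 := Subtype.ext h
    rw [LinearEquiv.map_eq_zero_iff] at h0
    exact hi (congrFun h0 i)
  · have h := mem_degreeLT.1 ((degreeLTEquiv E (ρ + 1)).symm c).2
    generalize ((degreeLTEquiv E (ρ + 1)).symm c : E[X]) = L at h ⊢
    rw [← mem_degreeLT, degreeLT_succ_eq_degreeLE, mem_degreeLE] at h
    exact natDegree_le_of_degree_le h
  · rw [hsum]
    have h := congrArg (Submodule.subtype _) hc
    simpa [RatFunc.smul_eq_C_mul] using h

end Dimension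

/-! ### Control of denominators -/

section Denominators

variable {E : Type*} [Field E]

/-- The subring of the rational functions whose denominator divides a power of `d`. -/
def awaySubring (d : E[X]) (hd : d ≠ 0) : Subring (RatFunc E) where
  carrier := {g | ∃ (n : ℕ) (a : E[X]),
    g = algebraMap E[X] (RatFunc E) a / algebraMap E[X] (RatFunc E) (d ^ n)}
  zero_mem' := ⟨0, 0, by simp⟩
  one_mem' := ⟨0, 1, by simp⟩
  add_mem' := by
    rintro _ _ ⟨n, a, rfl⟩ ⟨m, c, rfl⟩
    refine ⟨n + m, a * d ^ m + c * d ^ n, ?_⟩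
    have hd' := RatFunc.algebraMap_ne_zero hd
    simp only [map_add, map_mul, map_pow]
    field_simp
    ring
  neg_mem' := by
    rintro _ ⟨n, a, rfl⟩
    exact ⟨n, -a, by rw [map_neg, neg_div]⟩
  mul_mem' := by
    rintro _ _ ⟨n, a, rfl⟩ ⟨m, c, rfl⟩
    exact ⟨n + m, a * c, by rw [div_mul_div_comm, map_mul, pow_add, map_mul]⟩

theorem mem_awaySubring_of_denom_dvd {d : E[X]} {hd : d ≠ 0} {g : RatFunc E} {n : ℕ}
    (h : g.denom ∣ d ^ n) : g ∈ awaySubring d hd := by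
  obtain ⟨c, hc⟩ := h
  have hc0 : c ≠ 0 := right_ne_zero_of_mul (hc ▸ pow_ne_zero n hd)
  refine ⟨n, g.num * c, ?_⟩
  rw [hc, map_mul, map_mul, mul_div_mul_right _ _ (RatFunc.algebraMap_ne_zero hc0),
    RatFunc.num_div_denom]

theorem extendToRatFunc_mem_awaySubring {R : Type*} [CommRing R] [Algebra R E]
    (δ : Derivation R E[X] E[X]) {d : E[X]} {hd : d ≠ 0} {g : RatFunc E}
    (hg : g ∈ awaySubring d hd) : extendToRatFunc δ g ∈ awaySubring d hd := by
  obtain ⟨n, a, rfl⟩ := hg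
  refine ⟨n * 2, δ a * d ^ n - a * δ (d ^ n), ?_⟩
  rw [extendToRatFunc_div δ a (pow_ne_zero n hd), pow_mul, map_pow _ (d ^ n)]

theorem exists_dvd_pow_of_irreducible_dvd {B k : E[X]} (hB : B ≠ 0)
    (h : ∀ p, Irreducible p → p ∣ B → p ∣ k) : ∃ n : ℕ, B ∣ k ^ n := by
  induction B using WfDvdMonoid.induction_on_irreducible with
  | zero => exact absurd rfl hB
  | unit u hu => exact ⟨0, hu.dvd⟩
  | mul a p ha hp ih =>
    obtain ⟨n, hn⟩ := ih ha fun q hq hqa => h q hq (hqa.mul_left p)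
    exact ⟨n + 1, by rw [pow_succ']; exact mul_dvd_mul (h p hp (dvd_mul_right _ _)) hn⟩

/-- If `f' = δ K`, then the denominator of `f` divides a power of that of `K`. -/
theorem denom_dvd_pow_of_ratDeriv_eq [CharZero E] {R : Type*} [CommRing R] [Algebra R E]
    (δ : Derivation R E[X] E[X]) {f K : RatFunc E} (h : ratDeriv E f = extendToRatFunc δ K) :
    ∃ n : ℕ, f.denom ∣ K.denom ^ n := by
  refine exists_dvd_pow_of_irreducible_dvd f.denom_ne_zero fun p hp hpf => ?_
  have hf' := RatFunc.algebraMap_ne_zero f.denom_ne_zero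
  have hK' := RatFunc.algebraMap_ne_zero K.denom_ne_zero
  rw [← RatFunc.num_div_denom f, ← RatFunc.num_div_denom K, ratDeriv_div _ f.denom_ne_zero,
    extendToRatFunc_div _ _ K.denom_ne_zero, div_eq_div_iff (pow_ne_zero 2 hf')
    (pow_ne_zero 2 hK')] at h
  simp only [← map_mul, ← map_pow] at h
  have h2 := RatFunc.algebraMap_injective E h
  exact hp.prime.dvd_of_dvd_pow (dvd_of_dvd_of_deriv_eq f.isCoprime_num_denom f.denom_ne_zero
    hp hpf ((mul_comm _ _).trans h2))

end Denominators

/-! ### Orders and right division of differential operators -/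

section Operators

variable {F : Type*} [Field F]

/-- Left multiplication by `D_x` shifts the top coefficient up by one and leaves it unchanged; the
differentiated coefficients only enter below it. -/
theorem DiffOp.coeffDeriv_add_X_mul_iterate (i : ℕ) (N : DiffOp F) (n : ℕ)
    (hN : N.natDegree ≤ n) :
    ((fun N : DiffOp F => coeffDeriv (ratDeriv F) N + X * N)^[i] N).natDegree ≤ n + i ∧
      ((fun N : DiffOp F => coeffDeriv (ratDeriv F) N + X * N)^[i] N).coeff (n + i) =
        N.coeff n := by
  induction i with
  | zero => exact ⟨hN, rfl⟩
  | succ i ih =>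
    rw [Function.iterate_succ_apply']
    set M := (fun N : DiffOp F => coeffDeriv (ratDeriv F) N + X * N)^[i] N
    have hc : ∀ j, (coeffDeriv (ratDeriv F) M).coeff j = ratDeriv F (M.coeff j) := fun j => rfl
    have hlt : ∀ j, n + i < j → M.coeff j = 0 := fun j hj =>
      coeff_eq_zero_of_natDegree_lt (ih.1.trans_lt hj)
    constructor
    · rw [natDegree_le_iff_coeff_eq_zero]
      intro j hj
      obtain ⟨j, rfl⟩ : ∃ k, j = k + 1 := ⟨j - 1, by omega⟩
      rw [coeff_add, hc, coeff_X_mul, hlt _ (by omega), hlt j (by omega), map_zero, add_zero]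
    · rw [coeff_add, hc, ← add_assoc, coeff_X_mul, hlt _ (by omega), map_zero, zero_add, ih.2]

theorem DiffOp.coeff_comp (Q L : DiffOp F) :
    (Q.comp L).coeff (L.natDegree + Q.natDegree) = Q.leadingCoeff * L.leadingCoeff := by
  rw [DiffOp.comp, Polynomial.sum, finsetSum_coeff, Finset.sum_eq_single Q.natDegree]
  · rw [coeff_C_mul, (coeffDeriv_add_X_mul_iterate _ L _ le_rfl).2]
    rfl
  · intro i hi hne
    have := le_natDegree_of_mem_supp i hi
    rw [coeff_C_mul]
    refine mul_eq_zero_of_right _ (coeff_eq_zero_of_natDegree_lt ?_)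
    refine (coeffDeriv_add_X_mul_iterate i L _ le_rfl).1.trans_lt ?_
    omega
  · intro h
    rw [notMem_support_iff.1 h, C_0, zero_mul, coeff_zero]

theorem DiffOp.order_le_order_comp (Q L : DiffOp F) (h : Q.comp L ≠ 0) (hL : L ≠ 0) :
    L.order ≤ (Q.comp L).order := by
  have hQ : Q ≠ 0 := by
    rintro rfl
    exact h (Polynomial.sum_zero_index _)
  refine (Nat.le_add_right _ Q.natDegree).trans (le_natDegree_of_ne_zero ?_)
  rw [DiffOp.order, coeff_comp]
  exact mul_ne_zero (leadingCoeff_ne_zero.2 hQ) (leadingCoeff_ne_zero.2 hL)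

theorem DiffOp.add_monomial_comp (Q L : DiffOp F) (k : ℕ) (a : RatFunc F) :
    DiffOp.comp (Q + monomial k a) L = Q.comp L +
      C a * (fun N : DiffOp F => coeffDeriv (ratDeriv F) N + X * N)^[k] L := by
  unfold DiffOp.comp
  rw [Polynomial.sum_add_index _ _ _ (fun i => by simp) (fun i a b => by rw [C_add, add_mul]),
    Polynomial.sum_monomial_index _ _ (by simp)]

/-- Left ideals of the ring of differential operators are principal. -/
theorem DiffOp.exists_generator (I : Submodule (RatFunc F) (DiffOp F))
    (hI : ∀ N ∈ I, coeffDeriv (ratDeriv F) N + X * N ∈ I) (hne : ∃ L ∈ I, L ≠ 0) :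
    ∃ L ∈ I, L ≠ 0 ∧ ∀ L' ∈ I, ∃ Q : DiffOp F, L' = Q.comp L := by
  classical
  have hex : ∃ n : ℕ, ∃ L ∈ I, L ≠ 0 ∧ L.natDegree = n :=
    let ⟨L, hL, hL0⟩ := hne
    ⟨_, L, hL, hL0, rfl⟩
  obtain ⟨L, hL, hL0, hLn⟩ := Nat.find_spec hex
  have hmin : ∀ L' ∈ I, L' ≠ 0 → L.natDegree ≤ L'.natDegree := fun L' hL' h0 =>
    hLn.le.trans (Nat.find_min' hex ⟨L', hL', h0, rfl⟩)
  refine ⟨L, hL, hL0, fun L' hL' => ?_⟩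
  induction hn : L'.natDegree using Nat.strong_induction_on generalizing L' with
  | _ n ih =>
  subst hn
  rcases eq_or_ne L' 0 with rfl | h0
  · exact ⟨0, (Polynomial.sum_zero_index _).symm⟩
  obtain ⟨k, hk⟩ := Nat.exists_eq_add_of_le (hmin L' hL' h0)
  -- Right division step: `a D_x ^ k L` has the leading term of `L'`.
  set a := L'.leadingCoeff / L.leadingCoeff with ha
  set M := (fun N : DiffOp F => coeffDeriv (ratDeriv F) N + X * N)^[k] L with hM
  obtain ⟨hMd, hMc⟩ := coeffDeriv_add_X_mul_iterate k L _ le_rfl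
  have hMI : ∀ j, (fun N : DiffOp F => coeffDeriv (ratDeriv F) N + X * N)^[j] L ∈ I := by
    intro j
    induction j with
    | zero => exact hL
    | succ j ihj => rw [Function.iterate_succ_apply']; exact hI _ ihj
  have hmem : L' - C a * M ∈ I := by
    rw [← smul_eq_C_mul]
    exact sub_mem hL' (Submodule.smul_mem _ _ (hMI k))
  obtain ⟨Q, hQ⟩ : ∃ Q : DiffOp F, L' - C a * M = Q.comp L := by
    rcases eq_or_ne (L' - C a * M) 0 with h | h
    · exact ⟨0, h.trans (Polynomial.sum_zero_index _).symm⟩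
    refine ih _ (lt_of_le_of_ne ?_ fun heq => h ?_) _ hmem rfl
    · refine (natDegree_sub_le _ _).trans (max_le le_rfl ?_)
      exact (natDegree_C_mul_le _ _).trans (hMd.trans hk.ge)
    · rw [← leadingCoeff_eq_zero, leadingCoeff, heq, coeff_sub, coeff_C_mul, coeff_natDegree]
      rw [hk, hMc, coeff_natDegree, ha, div_mul_cancel₀ _ (leadingCoeff_ne_zero.2 hL0), sub_self]
  exact ⟨Q + monomial k a, by rw [add_monomial_comp, ← hQ, sub_add_cancel]⟩

end Operators

/-! ### Telescopers and residual sequences -/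

section Telescopers

variable {F : Type*} [Field F] {Φ : Type*} [Field Φ] [Algebra (RatFunc (RatFunc F)) Φ]
  {Dx Dy : Derivation ℤ Φ Φ} {T : Φ} {K f : RatFunc (RatFunc F)}

theorem IsDifferentialExtension.deriv_y_mul (hΦ : IsDifferentialExtension (F := F) Dx Dy)
    (hTy : Dy T = algebraMap _ Φ K * T) (u : RatFunc (RatFunc F)) :
    Dy (algebraMap _ Φ u * T) = algebraMap _ Φ (twistedDeriv K u) * T := by
  rw [Derivation.leibniz, hΦ.extends_y, hTy, twistedDeriv_apply, map_add, map_mul]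
  change _ = (algebraMap _ Φ (partialY F u) + _) * T
  simp only [smul_eq_mul]
  ring

theorem IsDifferentialExtension.deriv_x_mul (hΦ : IsDifferentialExtension (F := F) Dx Dy)
    (hTx : Dx T = algebraMap _ Φ f * T) (u : RatFunc (RatFunc F)) :
    Dx (algebraMap _ Φ u * T) = algebraMap _ Φ (partialX F u + f * u) * T := by
  rw [Derivation.leibniz, hΦ.extends_x, hTx, map_add, map_mul]
  simp only [smul_eq_mul]
  ring

/-- Compatibility of the two logarithmic derivatives. -/
theorem IsDifferentialExtension.partialY_eq (hΦ : IsDifferentialExtension (F := F) Dx Dy)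
    (hT0 : T ≠ 0) (hTx : Dx T = algebraMap _ Φ f * T) (hTy : Dy T = algebraMap _ Φ K * T) :
    partialY F f = partialX F K := by
  have h := hΦ.comm T
  rw [hTy, hTx, hΦ.deriv_x_mul hTx, hΦ.deriv_y_mul hTy] at h
  have h2 := (algebraMap (RatFunc (RatFunc F)) Φ).injective (mul_right_cancel₀ hT0 h)
  rw [twistedDeriv_apply] at h2
  change _ = partialY F f + _ at h2
  linear_combination -h2

theorem DiffOp.apply_smul (Dx : Derivation ℤ Φ Φ) (a : RatFunc F) (L : DiffOp F) (h : Φ) :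
    DiffOp.apply Dx (a • L) h =
      algebraMap (RatFunc (RatFunc F)) Φ (RatFunc.C a) * L.apply Dx h := by
  unfold DiffOp.apply
  rw [Polynomial.sum_smul_index _ _ _ (by simp), Polynomial.sum, Polynomial.sum, Finset.mul_sum]
  simp only [map_mul, mul_assoc]

theorem DiffOp.X_comp (L : DiffOp F) :
    DiffOp.comp X L = coeffDeriv (ratDeriv F) L + X * L := by
  rw [DiffOp.comp, Polynomial.sum_X_index (by simp), C_1, one_mul]
  rfl

theorem DiffOp.apply_X (Dx : Derivation ℤ Φ Φ) (h : Φ) :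
    DiffOp.apply Dx (X : DiffOp F) h = Dx h := by
  rw [← monomial_one_one_eq_X, DiffOp.apply_monomial]
  simp

/-- The operators `L` for which `L(H)` is the `y`-derivative of a rational multiple of `T`. -/
def telescoperIdeal (hΦ : IsDifferentialExtension (F := F) Dx Dy)
    (hTy : Dy T = algebraMap _ Φ K * T) (H : Φ) : Submodule (RatFunc F) (DiffOp F) where
  carrier := {L | ∃ u : RatFunc (RatFunc F), L.apply Dx H = Dy (algebraMap _ Φ u * T)}
  zero_mem' := ⟨0, by
    rw [map_zero, zero_mul, map_zero]
    exact Polynomial.sum_zero_index _⟩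
  add_mem' := by
    rintro L M ⟨u, hu⟩ ⟨v, hv⟩
    refine ⟨u + v, ?_⟩
    change DiffOp.applyHom Dx H (L + M) = _
    rw [map_add, map_add, add_mul, map_add, ← hu, ← hv]
    rfl
  smul_mem' := by
    rintro a L ⟨u, hu⟩
    refine ⟨a • u, ?_⟩
    rw [DiffOp.apply_smul, hu, hΦ.deriv_y_mul hTy, hΦ.deriv_y_mul hTy, map_smul,
      RatFunc.smul_eq_C_mul, map_mul, mul_assoc]

theorem mem_telescoperIdeal {hΦ : IsDifferentialExtension (F := F) Dx Dy}
    {hTy : Dy T = algebraMap _ Φ K * T} {H : Φ} {L : DiffOp F} :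
    L ∈ telescoperIdeal hΦ hTy H ↔
      ∃ u : RatFunc (RatFunc F), L.apply Dx H = Dy (algebraMap _ Φ u * T) := Iff.rfl

/-- `D_x D_y (uT) = D_y D_x (uT)`, and `D_x (uT)` is again a rational multiple of `T`. -/
theorem deriv_mem_telescoperIdeal {hΦ : IsDifferentialExtension (F := F) Dx Dy}
    {hTy : Dy T = algebraMap _ Φ K * T} {H : Φ} (hTx : Dx T = algebraMap _ Φ f * T)
    {L : DiffOp F} (hL : L ∈ telescoperIdeal hΦ hTy H) :
    coeffDeriv (ratDeriv F) L + X * L ∈ telescoperIdeal hΦ hTy H := by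
  obtain ⟨u, hu⟩ := hL
  refine ⟨partialX F u + f * u, ?_⟩
  rw [← DiffOp.X_comp, DiffOp.apply_comp hΦ, DiffOp.apply_X, hu, hΦ.comm, hΦ.deriv_x_mul hTx]

theorem isHyperexponential_mul (hΦ : IsDifferentialExtension (F := F) Dx Dy) (hT0 : T ≠ 0)
    (hTx : Dx T = algebraMap _ Φ f * T) (hTy : Dy T = algebraMap _ Φ K * T)
    {u : RatFunc (RatFunc F)} (hu : u ≠ 0) :
    IsHyperexponential F Dx Dy (algebraMap _ Φ u * T) := by
  have hu' : algebraMap (RatFunc (RatFunc F)) Φ u ≠ 0 := by simpa using hu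
  refine ⟨mul_ne_zero hu' hT0, ⟨(partialX F u + f * u) / u, ?_⟩, ⟨twistedDeriv K u / u, ?_⟩⟩
  · rw [hΦ.deriv_x_mul hTx, mul_div_mul_right _ _ hT0, map_div₀]
  · rw [hΦ.deriv_y_mul hTy, mul_div_mul_right _ _ hT0, map_div₀]

/-- A telescoper allows an arbitrary hyperexponential `G`, not only a rational multiple of `T`. If
`L(H) = sT` with `s ≠ 0`, then `sT = D_y(G) = gG` forces `G = (s / g) T`. -/
theorem isTelescoper_iff_mem (hΦ : IsDifferentialExtension (F := F) Dx Dy) (hT0 : T ≠ 0)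
    (hTx : Dx T = algebraMap _ Φ f * T) (hTy : Dy T = algebraMap _ Φ K * T) {H : Φ}
    {L : DiffOp F} (hL : ∃ g : RatFunc (RatFunc F), L.apply Dx H = algebraMap _ Φ g * T) :
    IsTelescoper Dx Dy H L ↔ L ≠ 0 ∧ L ∈ telescoperIdeal hΦ hTy H := by
  refine and_congr_right fun _ => ?_
  rw [mem_telescoperIdeal]
  constructor
  · rintro ⟨G, ⟨hG0, -, g, hg⟩, hLG⟩
    obtain ⟨s, hs⟩ := hL
    rw [div_eq_iff hG0] at hg
    -- If `L(H) = 0`, then `G` may be unrelated to `T`, but `u = 0` works.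
    rcases eq_or_ne s 0 with rfl | hs0
    · exact ⟨0, by rw [hs]; simp⟩
    · have hs' : algebraMap (RatFunc (RatFunc F)) Φ s ≠ 0 := by simpa using hs0
      have hsg : algebraMap _ Φ s * T = algebraMap _ Φ g * G := by rw [← hs, hLG, hg]
      have hg' : algebraMap (RatFunc (RatFunc F)) Φ g ≠ 0 := by
        intro h
        rw [h, zero_mul] at hsg
        exact mul_ne_zero hs' hT0 hsg
      refine ⟨s / g, ?_⟩
      rw [hLG, map_div₀, div_mul_eq_mul_div, hsg, mul_div_cancel_left₀ _ hg']
  · rintro ⟨u, hu⟩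
    rcases eq_or_ne u 0 with rfl | hu0
    -- `0` is not hyperexponential, so the constant `1` replaces it.
    · refine ⟨1, ⟨one_ne_zero, ⟨0, ?_⟩, ⟨0, ?_⟩⟩, ?_⟩
      · rw [Derivation.map_one_eq_zero, zero_div, map_zero]
      · rw [Derivation.map_one_eq_zero, zero_div, map_zero]
      · rw [hu, map_zero, zero_mul, map_zero, Derivation.map_one_eq_zero]
    · exact ⟨_, isHyperexponential_mul hΦ hT0 hTx hTy hu0, hu⟩

/-- On rational multiples of `T`, `D_x` acts as `s ↦ D_x s + f s`. This preserves the ring of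
fractions over powers of `b k₂`, because `D_y f = D_x K` confines the poles of `f` to `k₂`. -/
theorem exists_iterate_eq [CharZero F] (hΦ : IsDifferentialExtension (F := F) Dx Dy)
    (hT0 : T ≠ 0) (hTx : Dx T = algebraMap _ Φ f * T) (hTy : Dy T = algebraMap _ Φ K * T)
    {S : RatFunc (RatFunc F)} {b : (RatFunc F)[X]} (hb : IsSquarefreePart b S.denom)
    (hbK : b * K.denom ≠ 0) (i : ℕ) :
    ∃ s ∈ awaySubring (b * K.denom) hbK,
      Dx^[i] (algebraMap _ Φ S * T) = algebraMap _ Φ s * T := by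
  have hf : f ∈ awaySubring (b * K.denom) hbK := by
    obtain ⟨n, hn⟩ := denom_dvd_pow_of_ratDeriv_eq _ (hΦ.partialY_eq hT0 hTx hTy)
    exact mem_awaySubring_of_denom_dvd (hn.trans (pow_dvd_pow_of_dvd (dvd_mul_left _ _) n))
  induction i with
  | zero =>
    obtain ⟨n, hn⟩ := hb.2.2
    exact ⟨S, mem_awaySubring_of_denom_dvd
      (hn.trans (pow_dvd_pow_of_dvd (dvd_mul_right _ _) n)), rfl⟩
  | succ i ih =>
    obtain ⟨s, hs, h⟩ := ih
    refine ⟨partialX F s + f * s,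
      add_mem (extendToRatFunc_mem_awaySubring _ hs) (mul_mem hf hs), ?_⟩
    rw [Function.iterate_succ_apply', h, hΦ.deriv_x_mul hTx]

theorem DiffOp.apply_eq_of_iterate {H : Φ} {s : ℕ → RatFunc (RatFunc F)}
    (hs : ∀ i, Dx^[i] H = algebraMap _ Φ (s i) * T) (L : DiffOp F) :
    L.apply Dx H = algebraMap _ Φ (L.sum fun i e => RatFunc.C e * s i) * T := by
  unfold DiffOp.apply
  simp only [Polynomial.sum, map_sum, map_mul, Finset.sum_mul, hs, mul_assoc]

theorem sum_C_mul_mem (N : Submodule (RatFunc F) (RatFunc (RatFunc F))) (L : DiffOp F)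
    {r : ℕ → RatFunc (RatFunc F)} (hr : ∀ i, r i ∈ N) :
    (L.sum fun i e => RatFunc.C e * r i) ∈ N := by
  refine Submodule.sum_mem _ fun i _ => ?_
  dsimp only
  rw [← RatFunc.smul_eq_C_mul]
  exact Submodule.smul_mem _ _ (hr i)

theorem mem_telescoperIdeal_iff_sum_eq_zero [CharZero F]
    {hΦ : IsDifferentialExtension (F := F) Dx Dy} (hT0 : T ≠ 0)
    {hTy : Dy T = algebraMap _ Φ K * T} {H : Φ} (hK : IsDifferentialReduced K)
    {b : (RatFunc F)[X]} (hb : Squarefree b) (hbK : IsCoprime b K.denom)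
    {r : ℕ → RatFunc (RatFunc F)} (hr : ∀ i, r i ∈ residualForms K b)
    (hH : ∀ i, ∃ u : RatFunc (RatFunc F),
      Dx^[i] H = Dy (algebraMap _ Φ u * T) + algebraMap _ Φ (r i) * T) (L : DiffOp F) :
    L ∈ telescoperIdeal hΦ hTy H ↔ (L.sum fun i e => RatFunc.C e * r i) = 0 := by
  choose u hu using hH
  have hs : ∀ i, Dx^[i] H = algebraMap _ Φ (twistedDeriv K (u i) + r i) * T := fun i => by
    rw [hu, hΦ.deriv_y_mul hTy, map_add, add_mul]
  have hsum : (L.sum fun i e => RatFunc.C e * (twistedDeriv K (u i) + r i)) =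
      twistedDeriv K (L.sum fun i e => RatFunc.C e * u i) +
        L.sum fun i e => RatFunc.C e * r i := by
    simp only [← RatFunc.smul_eq_C_mul, Polynomial.sum, map_sum, map_smul, smul_add,
      Finset.sum_add_distrib]
  rw [mem_telescoperIdeal, DiffOp.apply_eq_of_iterate hs, hsum]
  constructor
  · rintro ⟨v, hv⟩
    rw [hΦ.deriv_y_mul hTy] at hv
    have h := (algebraMap (RatFunc (RatFunc F)) Φ).injective (mul_right_cancel₀ hT0 hv)
    refine IsResidualForm.eq_zero hK (u := v - L.sum fun i e => RatFunc.C e * u i)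
      (isResidualForm_of_mem hb hbK (sum_C_mul_mem _ L hr)) ?_
    rw [map_sub, ← h, add_sub_cancel_left]
  · intro h
    exact ⟨_, by rw [h, add_zero, hΦ.deriv_y_mul hTy]⟩

theorem IsResidualSequence.unique [CharZero F] (hΦ : IsDifferentialExtension (F := F) Dx Dy)
    (hT0 : T ≠ 0) (hTy : Dy T = algebraMap _ Φ K * T) (hK : IsDifferentialReduced K) {H : Φ}
    {r s : ℕ → RatFunc (RatFunc F)} (hr : IsResidualSequence Dx Dy H T K r)
    (hs : IsResidualSequence Dx Dy H T K s) : r = s := by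
  funext i
  obtain ⟨hri, u, hu⟩ := hr i
  obtain ⟨hsi, v, hv⟩ := hs i
  rw [hu, hΦ.deriv_y_mul hTy, hΦ.deriv_y_mul hTy, ← add_mul, ← add_mul, ← map_add,
    ← map_add] at hv
  have h := (algebraMap (RatFunc (RatFunc F)) Φ).injective (mul_right_cancel₀ hT0 hv)
  refine sub_eq_zero.1 (IsResidualForm.eq_zero hK (u := v - u) (hri.sub hsi) ?_)
  rw [map_sub]
  linear_combination -h

end Telescopers

end HyperexpTelescoping

end

/-! ### The main theorem -/

theorem mainTheorem2 {F : Type*} [Field F] [CharZero F]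
    {Φ : Type*} [Field Φ] [Algebra (RatFunc (RatFunc F)) Φ] (Dx Dy : Derivation ℤ Φ Φ)
    (hΦ : HyperexpTelescoping.IsDifferentialExtension (F := F) Dx Dy)
    (H : Φ) (hH : HyperexpTelescoping.IsHyperexponential F Dx Dy H)
    (g K S : RatFunc (RatFunc F)) (hg : Dy H / H = algebraMap (RatFunc (RatFunc F)) Φ g)
    (hKS : HyperexpTelescoping.IsKernelShell g K S)
    (T : Φ) (hT : H = algebraMap (RatFunc (RatFunc F)) Φ S * T)
    (b : (RatFunc F)[X]) (hb : HyperexpTelescoping.IsSquarefreePart b S.denom) :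
    (∃! r : ℕ → RatFunc (RatFunc F), HyperexpTelescoping.IsResidualSequence Dx Dy H T K r) ∧
    (∀ r : ℕ → RatFunc (RatFunc F), HyperexpTelescoping.IsResidualSequence Dx Dy H T K r →
      (∀ i, ∃ q v : (RatFunc F)[X], q.degree < b.degree ∧
        v ∈ HyperexpTelescoping.standardComplement K ∧
        r i = algebraMap (RatFunc F)[X] (RatFunc (RatFunc F)) q / algebraMap _ _ b +
          algebraMap (RatFunc F)[X] (RatFunc (RatFunc F)) v / algebraMap _ _ K.denom) ∧
      (∀ L : HyperexpTelescoping.DiffOp F, L ≠ 0 →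
        (HyperexpTelescoping.IsTelescoper Dx Dy H L ↔
          (L.sum fun i e => RatFunc.C e * r i) = 0))) ∧
    (∃ L : HyperexpTelescoping.DiffOp F, HyperexpTelescoping.IsMinimalTelescoper Dx Dy H L) ∧
    (∀ L : HyperexpTelescoping.DiffOp F, HyperexpTelescoping.IsMinimalTelescoper Dx Dy H L →
      L.order ≤ b.natDegree + max K.num.natDegree (K.denom.natDegree - 1)) := by
  have hH0 := hH.1
  obtain ⟨-, ⟨h, hh⟩, -⟩ := hH
  obtain ⟨hK, hS0, hSK, hgK⟩ := hKS
  have hS' : algebraMap (RatFunc (RatFunc F)) Φ S ≠ 0 := by simpa using hS0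
  have hT0 : T ≠ 0 := by
    rintro rfl
    exact hH0 (by rw [hT, mul_zero])
  rw [div_eq_iff hH0] at hg hh
  have hTy : Dy T = algebraMap _ Φ K * T := by
    apply mul_left_cancel₀ hS'
    rw [hT, Derivation.leibniz, hΦ.extends_y, smul_eq_mul, smul_eq_mul, hgK, map_add,
      map_div₀] at hg
    change _ = (_ + algebraMap _ Φ (HyperexpTelescoping.partialY F S) / _) * _ at hg
    field_simp at hg
    linear_combination hg
  obtain ⟨f, hTx⟩ : ∃ f : RatFunc (RatFunc F), Dx T = algebraMap _ Φ f * T := by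
    refine ⟨h - HyperexpTelescoping.partialX F S / S, ?_⟩
    apply mul_left_cancel₀ hS'
    rw [hT, Derivation.leibniz, hΦ.extends_x, smul_eq_mul, smul_eq_mul] at hh
    rw [map_sub, map_div₀]
    field_simp
    linear_combination hh
  have hbs := hb.1
  have hbK : IsCoprime b K.denom := hSK.of_isCoprime_of_dvd_left hb.2.1
  have hd : b * K.denom ≠ 0 := mul_ne_zero hbs.ne_zero K.denom_ne_zero
  choose s hs hsH using HyperexpTelescoping.exists_iterate_eq hΦ hT0 hTx hTy hb hd
  rw [← hT] at hsH
  have hred : ∀ i, ∃ u : RatFunc (RatFunc F), ∃ r ∈ HyperexpTelescoping.residualForms K b,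
      s i = HyperexpTelescoping.twistedDeriv K u + r := fun i => by
    obtain ⟨n, a, ha⟩ := hs i
    rw [ha]
    exact HyperexpTelescoping.exists_reduction hK hbs hbK n a
  choose u r hr hsr using hred
  have hru : ∀ i, ∃ u : RatFunc (RatFunc F),
      Dx^[i] H = Dy (algebraMap _ Φ u * T) + algebraMap _ Φ (r i) * T := fun i =>
    ⟨u i, by rw [hsH, hsr, hΦ.deriv_y_mul hTy, map_add, add_mul]⟩
  have hrseq : HyperexpTelescoping.IsResidualSequence Dx Dy H T K r := fun i =>
    ⟨HyperexpTelescoping.isResidualForm_of_mem hbs hbK (hr i), hru i⟩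
  have hmem := HyperexpTelescoping.mem_telescoperIdeal_iff_sum_eq_zero (hΦ := hΦ) (hTy := hTy)
    hT0 hK hbs hbK hr hru
  have htel : ∀ L : HyperexpTelescoping.DiffOp F, HyperexpTelescoping.IsTelescoper Dx Dy H L ↔
      L ≠ 0 ∧ L ∈ HyperexpTelescoping.telescoperIdeal hΦ hTy H := fun L =>
    HyperexpTelescoping.isTelescoper_iff_mem hΦ hT0 hTx hTy
      ⟨_, HyperexpTelescoping.DiffOp.apply_eq_of_iterate hsH L⟩
  obtain ⟨L₁, hL₁0, hL₁deg, hL₁⟩ :=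
    HyperexpTelescoping.exists_relation_of_mem_residualForms hK b r hr
  have hL₁mem := (hmem L₁).2 hL₁
  refine ⟨⟨r, hrseq, fun r' hr' => hr'.unique hΦ hT0 hTy hK hrseq⟩, ?_, ?_, ?_⟩
  · intro r' hr'
    obtain rfl := hr'.unique hΦ hT0 hTy hK hrseq
    refine ⟨fun i => (HyperexpTelescoping.mem_residualForms hbs.ne_zero).1 (hr i),
      fun L hL => ?_⟩
    rw [htel, hmem, and_iff_right hL]
  · obtain ⟨L, hL, hL0, hgen⟩ := HyperexpTelescoping.DiffOp.exists_generator
      (HyperexpTelescoping.telescoperIdeal hΦ hTy H)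
      (fun N hN => HyperexpTelescoping.deriv_mem_telescoperIdeal hTx hN) ⟨L₁, hL₁mem, hL₁0⟩
    exact ⟨L, (htel L).2 ⟨hL0, hL⟩, fun L' hL' => hgen L' ((htel L').1 hL').2⟩
  · intro L hL
    -- The short relation `L₁` is a left multiple of the minimal telescoper, so its order bounds
    -- that of `L`.
    obtain ⟨Q, rfl⟩ := hL.2 L₁ ((htel L₁).2 ⟨hL₁0, hL₁mem⟩)
    exact (HyperexpTelescoping.DiffOp.order_le_order_comp Q L hL₁0 hL.1.1).trans hL₁deg
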